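/- Let $G$ be a connected simple graph, finite or infinite, of maximum valence $3$. The distinguishing number $D(G)$ is the least number of colors in a (not necessarily proper) coloring of the vertices of $G$ whose only color-preserving automorphism is the identity. For $n \ge 1$ let $T_n$ be the finite tree, unique up to isomorphism, in which all vertices have valence $1$ or $3$ and every vertex of valence $1$ has distance exactly $n$ from a fixed root vertex. If $G$ has a leaf, that is, a vertex of valence $1$, then $D(G)\le 2$ or $G$ is isomorphic to $T_n$ for some $n\ge 1$. -/

import Mathlib

namespace Distinguishing

variable {V : Type*}

/-- The valence of a vertex: the number of its neighbors, infinite if there are infinitely many. -/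
noncomputable def valence (G : SimpleGraph V) (v : V) : ℕ∞ :=
  (G.neighborSet v).encard

/-- The maximum valence of `G` exists and equals `d`. -/
def HasMaxValence (G : SimpleGraph V) (d : ℕ) : Prop :=
  IsGreatest (Set.range (valence G)) (d : ℕ∞)

/-- A leaf is a vertex of valence 1. -/
def IsLeaf (G : SimpleGraph V) (v : V) : Prop :=
  valence G v = 1

/-- A coloring (not necessarily proper) of the vertices is distinguishing if the only
color-preserving automorphism is the identity. -/
def IsDistinguishing {α : Type*} (G : SimpleGraph V) (c : V → α) : Prop :=
  ∀ φ : G ≃g G, (∀ v, c (φ v) = c v) → ∀ v, φ v = v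

/-- The distinguishing number: the least number of colors in a distinguishing coloring.
The value is infinite (not a junk value) if no finite number of colors suffices. -/
noncomputable def distinguishingNumber (G : SimpleGraph V) : ℕ∞ :=
  ⨅ (k : ℕ) (_ : ∃ c : V → Fin k, IsDistinguishing G c), (k : ℕ∞)

/-- `G` is (isomorphic to) `T(n, d)`: the finite tree in which all vertices have valence 1 or `d`
and every vertex of valence 1 has the same distance `n` from a root vertex.

For `n ≥ 1` and `d ≥ 2` this determines the graph up to isomorphism: the root is not a leaf, and by
finiteness every path leading away from the root extends until it ends in a leaf, at distance
exactly `n`; so the root has `d` children, every other vertex at distance less than `n` from the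
root has `d - 1` children, and the vertices at distance `n` have none. Without finiteness the
infinite `d`-regular tree, which has no leaf, would qualify as well. -/
def IsT (n d : ℕ) (G : SimpleGraph V) : Prop :=
  Finite V ∧ G.IsTree ∧ (∀ v, valence G v = 1 ∨ valence G v = (d : ℕ∞)) ∧
    ∃ root : V, ∀ v, IsLeaf G v → G.dist root v = n

end Distinguishing

/-! If some leaf `l` is the only leaf at its neighbor, two colors suffice: in a breadth-first search
from `l` every other vertex has a parent, and a parent has at most two children, so ties can be
broken by color (`exists_rigidOn_of_single_leaf`). Otherwise every leaf has a sibling leaf. Apart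
from the claw and the path on three vertices, which two colors distinguish, leaves then come in
exact pairs whose common neighbor becomes a leaf once all leaves are deleted (`isClaw_or_paired`).
Coloring siblings differently extends a rigid coloring of the peeled graph
(`exists_rigidOn_of_peel`), so a graph without rigid coloring peels to another such graph with
leaves, and peeling can be repeated (`core_step`). If peeling reaches a claw, undoing it gives a
ternary tree (`isT_of_isClaw_core`). If it never does, any two vertices have a common ancestor, so
an automorphism fixes some ancestor of each vertex, and the colors of siblings carry this back down
(`exists_rigidOn_of_forall_paired`). -/

namespace Distinguishing

variable {V : Type*}

/-! ### Leaves of induced subgraphs, rigidity and tie-breaking -/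

/-- No vertex has four distinct neighbors. -/
def Subcubic (G : SimpleGraph V) : Prop :=
  ∀ v a b c d, G.Adj v a → G.Adj v b → G.Adj v c → G.Adj v d →
    a = b ∨ a = c ∨ a = d ∨ b = c ∨ b = d ∨ c = d

/-- `v` is a leaf of the subgraph induced by `S`, and `p` is its only neighbor there. -/
def Pendant (G : SimpleGraph V) (S : Set V) (v p : V) : Prop :=
  v ∈ S ∧ p ∈ S ∧ G.Adj v p ∧ ∀ q ∈ S, G.Adj v q → q = p

/-- The automorphisms of `G` that preserve `c` on `S` fix `S` pointwise. -/
def RigidOn (G : SimpleGraph V) (S : Set V) (c : V → Prop) : Prop :=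
  ∀ φ : G ≃g G, (∀ v ∈ S, c (φ v) ↔ c v) → ∀ v ∈ S, φ v = v

theorem Pendant.eq {G : SimpleGraph V} {S : Set V} {v p q : V} (h : Pendant G S v p)
    (hq : q ∈ S) (ha : G.Adj v q) : q = p :=
  h.2.2.2 q hq ha

theorem Pendant.unique {G : SimpleGraph V} {S : Set V} {v p q : V} (h : Pendant G S v p)
    (h' : Pendant G S v q) : q = p :=
  h.eq h'.2.1 h'.2.2.1

theorem pendant_map {G : SimpleGraph V} {S : Set V} (φ : G ≃g G) (hS : ∀ v, φ v ∈ S ↔ v ∈ S)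
    {v p : V} : Pendant G S (φ v) (φ p) ↔ Pendant G S v p := by
  unfold Pendant
  rw [hS, hS, φ.map_adj_iff]
  constructor
  · rintro ⟨h1, h2, h3, h4⟩
    exact ⟨h1, h2, h3, fun q hq ha => φ.injective (h4 (φ q) ((hS q).2 hq) (φ.map_adj_iff.2 ha))⟩
  · rintro ⟨h1, h2, h3, h4⟩
    refine ⟨h1, h2, h3, fun q hq ha => ?_⟩
    obtain ⟨q, rfl⟩ := φ.surjective q
    rw [h4 q ((hS q).1 hq) (φ.map_adj_iff.1 ha)]

/-- A symmetric relation in which every element has at most one partner separates the partners by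
the set of those elements that precede their partner in some linear order. -/
theorem exists_separating_set {α : Type*} (r : α → α → Prop) (hs : ∀ x y, r x y → r y x)
    (hi : ∀ x, ¬ r x x) (hu : ∀ x y z, r x y → r x z → y = z) :
    ∃ s : α → Prop, (∀ x, s x → ∃ y, r x y) ∧ ∀ x y, r x y → ¬ (s y ↔ s x) := by
  classical
  refine ⟨fun x => ∃ y, r x y ∧ WellOrderingRel x y, fun x ⟨y, h, _⟩ => ⟨y, h⟩, ?_⟩
  intro x y hxy hiff
  have hyx := hs x y hxy
  rcases trichotomous_of WellOrderingRel x y with h | h | h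
  · obtain ⟨z, hz, hlt⟩ := hiff.2 ⟨y, hxy, h⟩
    obtain rfl := hu y x z hyx hz
    exact asymm h hlt
  · subst h; exact hi x hxy
  · obtain ⟨z, hz, hlt⟩ := hiff.1 ⟨x, hyx, h⟩
    obtain rfl := hu x y z hxy hz
    exact asymm h hlt

/-! ### Breadth-first search from a lone leaf -/

theorem dist_map_iso {G : SimpleGraph V} (φ : G ≃g G) (u v : V) :
    G.dist (φ u) (φ v) = G.dist u v := by
  have key : ∀ (ψ : G ≃g G) (x y : V), G.Reachable x y → G.dist (ψ x) (ψ y) ≤ G.dist x y := by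
    intro ψ x y h
    obtain ⟨p, hp⟩ := h.exists_walk_length_eq_dist
    rw [← hp, ← SimpleGraph.Walk.length_map ψ.toHom p]
    exact SimpleGraph.dist_le _
  by_cases h : G.Reachable u v
  · refine le_antisymm (key φ u v h) ?_
    have := key φ.symm (φ u) (φ v) (h.map φ.toHom)
    simpa using this
  · have h' : ¬ G.Reachable (φ u) (φ v) := fun h' => h (by simpa using h'.map φ.symm.toHom)
    rw [SimpleGraph.dist_eq_zero_of_not_reachable h, SimpleGraph.dist_eq_zero_of_not_reachable h']

theorem exists_adj_dist_succ {G : SimpleGraph V} {u v : V} (h : G.Reachable u v) (hne : v ≠ u) :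
    ∃ q, G.Adj v q ∧ G.dist u q + 1 = G.dist u v := by
  obtain ⟨p, hp⟩ := h.symm.exists_walk_length_eq_dist
  cases p with
  | nil => exact absurd rfl hne
  | @cons _ q _ ha p =>
    refine ⟨q, ha, ?_⟩
    rw [SimpleGraph.Walk.length_cons] at hp
    have h1 : G.dist q u ≤ p.length := SimpleGraph.dist_le p
    have h2 := ha.reachable.dist_triangle_left u
    rw [SimpleGraph.dist_eq_one_iff_adj.2 ha] at h2
    rw [G.dist_comm (u := u) (v := q), G.dist_comm (u := u) (v := v)]
    omega

/-- A connected subcubic graph with a leaf whose neighbor has no other leaf is distinguished by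
two colors: break ties between vertices with the same parents in a breadth-first search. -/
theorem exists_rigidOn_of_single_leaf {G : SimpleGraph V} (hG : Subcubic G)
    (hc : G.Preconnected) {l p : V} (hl : Pendant G Set.univ l p)
    (hs : ∀ v, Pendant G Set.univ v p → v = l) : ∃ c, RigidOn G Set.univ c := by
  set d := G.dist l with hd
  -- Ties are refined by being a leaf, so that a leaf colored by `s` always has a sibling leaf; `l`
  -- has none and can thus share the color of `s`.
  let r : V → V → Prop := fun x y => x ≠ y ∧ x ≠ l ∧ d x = d y ∧
    (∀ q, d q + 1 = d x → (G.Adj x q ↔ G.Adj y q)) ∧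
    ((∃ q, Pendant G Set.univ x q) ↔ ∃ q, Pendant G Set.univ y q)
  have hpred : ∀ x, x ≠ l → ∃ q, G.Adj x q ∧ d q + 1 = d x := fun x hx =>
    exists_adj_dist_succ (hc l x) hx
  have hd0 : ∀ x, d x = 0 → x = l := fun x hx => ((hc l x).dist_eq_zero_iff.1 hx).symm
  have hdl : d l = 0 := by simp [hd]
  obtain ⟨s, hs1, hs2⟩ := exists_separating_set r
    (by
      rintro x y ⟨h1, h2, h3, h4, h5⟩
      refine ⟨h1.symm, ?_, h3.symm, fun q hq => (h4 q (by omega)).symm, h5.symm⟩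
      rintro rfl
      exact h2 (hd0 x (by omega)))
    (fun x h => h.1 rfl)
    (by
      rintro x y z ⟨h1, h2, h3, h4, -⟩ ⟨k1, k2, k3, k4, -⟩
      obtain ⟨q, hq, hdq⟩ := hpred x h2
      have hy := (h4 q hdq).1 hq
      have hz := (k4 q hdq).1 hq
      -- The parent `l` has a single child. Any other parent `q` spends one of its three neighbors
      -- on its own parent `t`, leaving two children.
      by_cases hql : q = l
      · subst hql
        exact absurd ((hl.eq trivial hq.symm).trans (hl.eq trivial hy.symm).symm) h1
      · obtain ⟨t, ht, hdt⟩ := hpred q hql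
        have e1 : x ≠ t := by rintro rfl; omega
        have e2 : y ≠ t := by rintro rfl; omega
        have e3 : z ≠ t := by rintro rfl; omega
        rcases hG q x y z t hq.symm hy.symm hz.symm ht with h | h | h | h | h | h <;>
          first | exact h | contradiction)
  refine ⟨fun x => x = l ∨ s x, ?_⟩
  intro φ hφ
  have hmap : ∀ v q, Pendant G Set.univ (φ v) (φ q) ↔ Pendant G Set.univ v q := fun v q =>
    pendant_map φ (fun v => by simp)
  have hleaf : ∀ v, (∃ q, Pendant G Set.univ (φ v) q) ↔ ∃ q, Pendant G Set.univ v q := by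
    intro v
    constructor
    · rintro ⟨q, hq⟩
      obtain ⟨q, rfl⟩ := φ.surjective q
      exact ⟨q, (hmap v q).1 hq⟩
    · rintro ⟨q, hq⟩
      exact ⟨φ q, (hmap v q).2 hq⟩
  have hfix : φ l = l := by
    have hcl := (hφ l trivial).2 (Or.inl rfl)
    rcases hcl with h | h
    · exact h
    · by_contra hne
      obtain ⟨y, h1, h2, h3, h4, h5⟩ := hs1 _ h
      obtain ⟨q, hq, hdq⟩ := hpred _ h2
      have hy := (h4 q hdq).1 hq
      obtain ⟨q', hyq⟩ := h5.1 ((hleaf l).2 ⟨p, hl⟩)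
      obtain rfl := hyq.eq trivial hy
      obtain ⟨y, rfl⟩ := φ.surjective y
      obtain ⟨q, rfl⟩ := φ.surjective q
      obtain rfl := hl.eq trivial (φ.map_adj_iff.1 hq)
      exact h1 (congrArg φ (hs y ((hmap _ _).1 hyq)).symm)
  have hdφ : ∀ x, d (φ x) = d x := by
    intro x
    have := dist_map_iso φ l x
    rwa [hfix] at this
  have main : ∀ n x, d x = n → φ x = x := by
    intro n
    induction n using Nat.strong_induction_on with
    | _ n ih =>
      intro x hx
      by_cases hxl : x = l
      · rw [hxl, hfix]
      by_contra hne
      have hφl : φ x ≠ l := fun h => hxl (φ.injective (h.trans hfix.symm))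
      have hr : r x (φ x) := by
        refine ⟨Ne.symm hne, hxl, (hdφ x).symm, fun q hq => ?_, (hleaf x).symm⟩
        conv_rhs => rw [← ih (d q) (by omega) q rfl]
        exact φ.map_adj_iff.symm
      apply hs2 _ _ hr
      have := hφ x trivial
      simpa [hxl, hφl] using this
  exact fun v _ => main _ v rfl

/-! ### Peeling off leaves -/

/-- `S` without the leaves of the subgraph induced by `S`. -/
def peel (G : SimpleGraph V) (S : Set V) : Set V :=
  {v ∈ S | ∀ p, ¬ Pendant G S v p}

/-- The vertices that remain after deleting all leaves `k` times. -/
def core (G : SimpleGraph V) : ℕ → Set V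
  | 0 => Set.univ
  | k + 1 => peel G (core G k)

/-- Every leaf of the subgraph induced by `S` has a second leaf as a sibling, and their common
neighbor becomes a leaf when all leaves are deleted. -/
def Paired (G : SimpleGraph V) (S : Set V) : Prop :=
  ∀ v p, Pendant G S v p → ∃ v' q, v' ≠ v ∧ Pendant G S v' p ∧ Pendant G (peel G S) p q

/-- The subgraph induced by `S` is a star with three leaves and center `r`. -/
def IsClaw (G : SimpleGraph V) (S : Set V) (r : V) : Prop :=
  ∃ a b c, a ≠ b ∧ a ≠ c ∧ b ≠ c ∧ Pendant G S a r ∧ Pendant G S b r ∧ Pendant G S c r ∧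
    ∀ x ∈ S, x = r ∨ x = a ∨ x = b ∨ x = c

theorem peel_subset (G : SimpleGraph V) (S : Set V) : peel G S ⊆ S := fun _ h => h.1

theorem core_antitone (G : SimpleGraph V) : Antitone (core G) :=
  antitone_nat_of_succ_le fun k => peel_subset G (core G k)

theorem map_mem_peel {G : SimpleGraph V} {S : Set V} (φ : G ≃g G) (hS : ∀ v, φ v ∈ S ↔ v ∈ S)
    (v : V) : φ v ∈ peel G S ↔ v ∈ peel G S := by
  simp only [peel, Set.mem_sep_iff, hS]
  refine and_congr_right fun _ => ⟨fun h p hp => h (φ p) ((pendant_map φ hS).2 hp), ?_⟩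
  intro h p hp
  obtain ⟨p, rfl⟩ := φ.surjective p
  exact h p ((pendant_map φ hS).1 hp)

theorem map_mem_core {G : SimpleGraph V} (φ : G ≃g G) (k : ℕ) :
    ∀ v, φ v ∈ core G k ↔ v ∈ core G k := by
  induction k with
  | zero => exact fun v => ⟨fun _ => trivial, fun _ => trivial⟩
  | succ k ih => exact map_mem_peel φ ih

theorem subset_of_adj_closed {G : SimpleGraph V} {S A : Set V} (hc : (G.induce S).Preconnected)
    {x : V} (hxS : x ∈ S) (hxA : x ∈ A) (h : ∀ y ∈ A, y ∈ S → ∀ z ∈ S, G.Adj y z → z ∈ A) :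
    S ⊆ A := by
  intro z hz
  have := (SimpleGraph.reachable_iff_reflTransGen _ _).1 (hc ⟨x, hxS⟩ ⟨z, hz⟩)
  generalize hw : (⟨z, hz⟩ : S) = w at this
  have hwA : (w : V) ∈ A := by
    clear hw
    induction this with
    | refl => exact hxA
    | @tail b c _ hbc ih => exact h b ih b.2 c c.2 hbc
  rw [← hw] at hwA
  exact hwA

/-- Sending each leaf to its neighbor retracts `S` onto its peel and maps every edge to an edge or a
single vertex. -/
theorem preconnected_peel {G : SimpleGraph V} {S : Set V} (hc : (G.induce S).Preconnected)
    (h : ∀ v p, Pendant G S v p → p ∈ peel G S) : (G.induce (peel G S)).Preconnected := by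
  classical
  have hex : ∀ v : S, ∃ w : peel G S, ((v : V) ∈ peel G S → (w : V) = v) ∧
      ∀ p, Pendant G S v p → (w : V) = p := by
    intro v
    by_cases hv : (v : V) ∈ peel G S
    · exact ⟨⟨v, hv⟩, fun _ => rfl, fun p hp => absurd hp (hv.2 p)⟩
    · have : ∃ p, Pendant G S v p := by
        by_contra hno
        exact hv ⟨v.2, fun p hp => hno ⟨p, hp⟩⟩
      obtain ⟨p, hp⟩ := this
      exact ⟨⟨p, h v p hp⟩, fun hv' => absurd hv' hv, fun p' hp' => hp'.unique hp⟩
  choose f hf1 hf2 using hex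
  have hstep : ∀ u v : S, (G.induce S).Adj u v → (G.induce (peel G S)).Reachable (f u) (f v) := by
    have key : ∀ u v : S, (G.induce S).Adj u v → ∀ p, Pendant G S u p → f u = f v := by
      intro u v ha p hp
      have e : (v : V) = p := hp.eq v.2 ha
      apply Subtype.ext
      rw [hf2 u p hp, hf1 v (e ▸ h u p hp), e]
    intro u v ha
    by_cases hu : ∃ p, Pendant G S u p
    · obtain ⟨p, hp⟩ := hu
      rw [key u v ha p hp]
    by_cases hv : ∃ p, Pendant G S v p
    · obtain ⟨p, hp⟩ := hv
      rw [key v u ha.symm p hp]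
    apply SimpleGraph.Adj.reachable
    have e1 := hf1 u ⟨u.2, fun p hp => hu ⟨p, hp⟩⟩
    have e2 := hf1 v ⟨v.2, fun p hp => hv ⟨p, hp⟩⟩
    simp only [SimpleGraph.comap_adj, Function.Embedding.subtype_apply, e1, e2]
    exact ha
  intro x y
  have hx : f ⟨x, x.2.1⟩ = x := Subtype.ext (hf1 ⟨x, x.2.1⟩ x.2)
  have hy : f ⟨y, y.2.1⟩ = y := Subtype.ext (hf1 ⟨y, y.2.1⟩ y.2)
  have hlift : ∀ a b : S, (G.induce (peel G S)).Reachable (f a) (f b) := by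
    intro a b
    have := (SimpleGraph.reachable_iff_reflTransGen _ _).1 (hc a b)
    induction this with
    | refl => exact SimpleGraph.Reachable.refl _
    | tail _ hbc ih => exact ih.trans (hstep _ _ hbc)
  rw [← hx, ← hy]
  exact hlift _ _

/-! ### One peeling step -/

theorem exists_rigidOn_of_single_pendant {G : SimpleGraph V} (hG : Subcubic G) {S : Set V}
    (hS : ∀ (φ : G ≃g G) v, φ v ∈ S ↔ v ∈ S) (hc : (G.induce S).Preconnected) {l p : V}
    (hl : Pendant G S l p) (hs : ∀ v, Pendant G S v p → v = l) : ∃ c, RigidOn G S c := by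
  classical
  have hH : Subcubic (G.induce S) := by
    intro v a b c d ha hb hc hd
    have := hG v a b c d ha hb hc hd
    simpa only [Subtype.ext_iff] using this
  have hpend : ∀ v q : S, Pendant (G.induce S) Set.univ v q ↔ Pendant G S v q := by
    intro v q
    constructor
    · rintro ⟨-, -, h1, h2⟩
      exact ⟨v.2, q.2, h1, fun t ht ha => congrArg Subtype.val (h2 ⟨t, ht⟩ trivial ha)⟩
    · rintro ⟨-, -, h1, h2⟩
      exact ⟨trivial, trivial, h1, fun t _ ha => Subtype.ext (h2 t t.2 ha)⟩
  obtain ⟨c, hcr⟩ := exists_rigidOn_of_single_leaf hH hc (l := ⟨l, hl.1⟩) (p := ⟨p, hl.2.1⟩)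
    ((hpend _ _).2 hl) (fun v hv => Subtype.ext (hs v ((hpend _ _).1 hv)))
  refine ⟨fun x => ∃ h : x ∈ S, c ⟨x, h⟩, fun φ hφ v hv => ?_⟩
  let ψ : G.induce S ≃g G.induce S :=
    { toEquiv := φ.toEquiv.subtypeEquiv fun a => (hS φ a).symm
      map_rel_iff' := φ.map_rel_iff' }
  have := hcr ψ (fun x _ => by
    have := hφ x x.2
    have hx : φ x ∈ S := (hS φ x).2 x.2
    change c ⟨φ x, hx⟩ ↔ c x
    simpa [hx] using this) ⟨v, hv⟩ trivial
  exact congrArg Subtype.val this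

/-- If the leaves come in pairs of siblings, a rigid coloring of what remains after deleting them
extends to a rigid coloring: color siblings differently. -/
theorem exists_rigidOn_of_peel {G : SimpleGraph V} {S : Set V}
    (hS : ∀ (φ : G ≃g G) v, φ v ∈ S ↔ v ∈ S)
    (hp : ∀ v p, Pendant G S v p → p ∈ peel G S ∧
      ∀ a b, Pendant G S a p → Pendant G S b p → v ≠ a → v ≠ b → a = b)
    (h : ∃ c, RigidOn G (peel G S) c) : ∃ c, RigidOn G S c := by
  obtain ⟨c, hc⟩ := h
  obtain ⟨s, -, hs⟩ := exists_separating_set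
    (fun x y => x ≠ y ∧ ∃ p, Pendant G S x p ∧ Pendant G S y p)
    (fun x y ⟨h1, p, h2, h3⟩ => ⟨h1.symm, p, h3, h2⟩) (fun x h => h.1 rfl)
    (by
      rintro x y z ⟨h1, p, h2, h3⟩ ⟨k1, q, k2, k3⟩
      obtain rfl := h2.unique k2
      exact (hp x _ h2).2 y z h3 k3 h1 k1)
  refine ⟨fun x => (x ∈ peel G S ∧ c x) ∨ (x ∉ peel G S ∧ s x), fun φ hφ => ?_⟩
  have hfix : ∀ v ∈ peel G S, φ v = v := by
    refine hc φ fun v hv => ?_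
    have := hφ v hv.1
    have hv' := (map_mem_peel φ (hS φ) v).2 hv
    simpa [hv, hv'] using this
  intro v hv
  by_cases hvp : v ∈ peel G S
  · exact hfix v hvp
  have hex : ∃ p, Pendant G S v p := by
    by_contra hno
    exact hvp ⟨hv, fun p hp => hno ⟨p, hp⟩⟩
  obtain ⟨p, hvp'⟩ := hex
  have h1 := (pendant_map φ (hS φ)).2 hvp'
  rw [hfix p (hp v p hvp').1] at h1
  by_contra hne
  refine hs v (φ v) ⟨Ne.symm hne, p, hvp', h1⟩ ?_
  have := hφ v hv
  have hv' := mt (map_mem_peel φ (hS φ) v).1 hvp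
  simpa [hvp, hv'] using this

/-- A connected invariant subgraph with a leaf that has no rigid coloring is a star with three
leaves, or its leaves come in pairs as in `Paired`. -/
theorem isClaw_or_paired {G : SimpleGraph V} (hG : Subcubic G) {S : Set V}
    (hS : ∀ (φ : G ≃g G) v, φ v ∈ S ↔ v ∈ S) (hc : (G.induce S).Preconnected)
    (hn : ¬ ∃ c, RigidOn G S c) : (∃ r, IsClaw G S r) ∨ Paired G S := by
  by_contra hcon
  push Not at hcon
  obtain ⟨hcl, hpa⟩ := hcon
  apply hpa
  intro v p hv
  have hsib : ∃ v', Pendant G S v' p ∧ v' ≠ v := by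
    by_contra hno
    push Not at hno
    exact hn (exists_rigidOn_of_single_pendant hG hS hc hv hno)
  obtain ⟨w, hw, hwv⟩ := hsib
  have hpp : p ∈ peel G S := by
    refine ⟨hv.2.1, fun z hz => hwv ?_⟩
    rw [hz.eq hv.1 hv.2.2.1.symm, hz.eq hw.1 hw.2.2.1.symm]
  by_cases hq : ∃ q ∈ S, G.Adj p q ∧ q ≠ v ∧ q ≠ w
  · obtain ⟨q, hqS, hpq, hqv, hqw⟩ := hq
    have hnb : ∀ z, G.Adj p z → z = v ∨ z = w ∨ z = q := by
      intro z hz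
      rcases hG p z v w q hz hv.2.2.1.symm hw.2.2.1.symm hpq with h | h | h | h | h | h
      · exact .inl h
      · exact .inr (.inl h)
      · exact .inr (.inr h)
      · exact absurd h.symm hwv
      · exact absurd h.symm hqv
      · exact absurd h.symm hqw
    by_cases hqp : q ∈ peel G S
    · refine ⟨w, q, hwv, hw, hpp, hqp, hpq, fun z hz ha => ?_⟩
      rcases hnb z ha with rfl | rfl | rfl
      · exact absurd hv (hz.2 p)
      · exact absurd hw (hz.2 p)
      · rfl
    -- The third neighbor of `p` is a leaf too, so connectedness leaves only a claw.
    · have hqe : ∃ z, Pendant G S q z := by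
        by_contra hno
        exact hqp ⟨hqS, fun p hp => hno ⟨p, hp⟩⟩
      obtain ⟨z, hz⟩ := hqe
      obtain rfl := hz.eq hv.2.1 hpq.symm
      refine absurd ⟨v, w, q, hwv.symm, hqv.symm, hqw.symm, hv, hw, hz, ?_⟩ (hcl p)
      refine subset_of_adj_closed (A := {x | x = p ∨ x = v ∨ x = w ∨ x = q}) hc hv.2.1 (.inl rfl) ?_
      rintro y (rfl | rfl | rfl | rfl) - t ht ha
      · exact .inr (hnb t ha)
      · exact .inl (hv.eq ht ha)
      · exact .inl (hw.eq ht ha)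
      · exact .inl (hz.eq ht ha)
  · push Not at hq
    have hnb : ∀ z ∈ S, G.Adj p z → z = v ∨ z = w := fun z hz ha => by
      by_cases h : z = v
      · exact .inl h
      · exact .inr (hq z hz ha h)
    have hsub : ∀ x ∈ S, x = p ∨ x = v ∨ x = w := by
      refine subset_of_adj_closed (A := {x | x = p ∨ x = v ∨ x = w}) hc hv.2.1 (.inl rfl) ?_
      rintro y (rfl | rfl | rfl) - t ht ha
      · exact .inr (hnb t ht ha)
      · exact .inl (hv.eq ht ha)
      · exact .inl (hw.eq ht ha)
    -- Here `S` is the path `v`, `p`, `w`; marking the end `v` makes it rigid.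
    refine absurd ⟨fun x => x = v, fun φ hφ => ?_⟩ hn
    have hφv : φ v = v := (hφ v hv.1).2 rfl
    have hφp : φ p = p := by
      apply hv.eq ((hS φ p).2 hv.2.1)
      have := φ.map_adj_iff.2 hv.2.2.1
      rwa [hφv] at this
    intro x hx
    rcases hsub x hx with rfl | rfl | rfl
    · exact hφp
    · exact hφv
    · rcases hsub _ ((hS φ x).2 hx) with h | h | h
      · exact absurd (φ.injective (h.trans hφp.symm)) hw.2.2.1.ne
      · exact absurd (φ.injective (h.trans hφv.symm)) hwv
      · exact h

/-- The neighbor `q` of `p` that survives peeling leaves room for only two leaves at `p`. -/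
theorem Paired.eq_of_ne {G : SimpleGraph V} (hG : Subcubic G) {S : Set V} (h : Paired G S)
    {v p a b : V} (hv : Pendant G S v p) (ha : Pendant G S a p) (hb : Pendant G S b p)
    (hva : v ≠ a) (hvb : v ≠ b) : a = b := by
  obtain ⟨-, q, -, -, hpq⟩ := h v p hv
  have hne : ∀ x, Pendant G S x p → x ≠ q := by
    rintro x hx rfl
    exact hpq.2.1.2 p hx
  rcases hG p v a b q hv.2.2.1.symm ha.2.2.1.symm hb.2.2.1.symm hpq.2.2.1 with
    h | h | h | h | h | h
  · exact absurd h hva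
  · exact absurd h hvb
  · exact absurd h (hne v hv)
  · exact h
  · exact absurd h (hne a ha)
  · exact absurd h (hne b hb)

/-! ### Iterated peeling and levels -/

theorem core_step {G : SimpleGraph V} (hG : Subcubic G) (hc : G.Preconnected)
    (hl : ∃ v p, Pendant G Set.univ v p) (hn : ¬ ∃ c, RigidOn G Set.univ c) (k : ℕ)
    (hk : ∀ i < k, ∀ r, ¬ IsClaw G (core G i) r) :
    (∀ i < k, Paired G (core G i)) ∧ (G.induce (core G k)).Preconnected ∧
      (¬ ∃ c, RigidOn G (core G k) c) ∧ ∃ v p, Pendant G (core G k) v p := by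
  induction k with
  | zero =>
    refine ⟨by simp, ?_, hn, hl⟩
    exact (SimpleGraph.induceUnivIso G).preconnected_iff.2 hc
  | succ k ih =>
    obtain ⟨h1, h2, h3, v, p, hv⟩ := ih fun i hi => hk i (by omega)
    have hS : ∀ (φ : G ≃g G) v, φ v ∈ core G k ↔ v ∈ core G k := fun φ => map_mem_core φ k
    have hP : Paired G (core G k) := by
      rcases isClaw_or_paired hG hS h2 h3 with ⟨r, h⟩ | h
      · exact absurd h (hk k (by omega) r)
      · exact h
    have hpar : ∀ v p, Pendant G (core G k) v p → p ∈ peel G (core G k) := by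
      intro v p hv
      obtain ⟨_, _, _, _, h⟩ := hP v p hv
      exact h.1
    refine ⟨fun i hi => ?_, preconnected_peel h2 hpar, fun h => h3 ?_, ?_⟩
    · rcases Nat.lt_succ_iff_lt_or_eq.1 hi with h | rfl
      · exact h1 i h
      · exact hP
    · exact exists_rigidOn_of_peel hS
        (fun v p hv => ⟨hpar v p hv, fun a b ha hb => hP.eq_of_ne hG hv ha hb⟩) h
    · obtain ⟨_, q, _, _, h⟩ := hP v p hv
      exact ⟨p, q, h⟩

theorem Pendant.core_level_unique {G : SimpleGraph V} {i j : ℕ} {x p q : V}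
    (h : Pendant G (core G i) x p) (h' : Pendant G (core G j) x q) : i = j := by
  have key : ∀ {i j : ℕ} {p q : V}, Pendant G (core G i) x p → Pendant G (core G j) x q →
      ¬ i < j := by
    intro i j p q h h' hij
    exact (core_antitone G (Nat.succ_le_of_lt hij) h'.1).2 p h
  have h1 := key h h'
  have h2 := key h' h
  omega

theorem exists_pendant_of_notMem_core {G : SimpleGraph V} {k : ℕ} {x : V} (h : x ∉ core G k) :
    ∃ i < k, ∃ p, Pendant G (core G i) x p := by
  induction k with
  | zero => exact absurd trivial h
  | succ k ih =>
    by_cases hx : x ∈ core G k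
    · by_contra hno
      push Not at hno
      exact h ⟨hx, fun p hp => hno k (by omega) p hp⟩
    · obtain ⟨i, hi, hp⟩ := ih hx
      exact ⟨i, by omega, hp⟩

/-! ### Endless peeling -/

/-- If deleting leaves never ends and the leaves come in pairs at every stage, every vertex is
eventually deleted. -/
theorem exists_pendant_of_forall_paired {G : SimpleGraph V} (hc : G.Preconnected)
    (hP : ∀ k, Paired G (core G k)) (hl : ∃ v p, Pendant G Set.univ v p) (x : V) :
    ∃ i p, Pendant G (core G i) x p := by
  obtain ⟨v, p, hv⟩ := hl
  have := (SimpleGraph.reachable_iff_reflTransGen _ _).1 (hc v x)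
  induction this with
  | refl => exact ⟨0, p, hv⟩
  | @tail b c _ hbc ih =>
    obtain ⟨i, q, hb⟩ := ih
    by_cases h : c ∈ core G i
    · obtain rfl := hb.eq h hbc
      obtain ⟨_, t, _, _, ht⟩ := hP i b c hb
      exact ⟨i + 1, t, ht⟩
    · obtain ⟨j, _, hj⟩ := exists_pendant_of_notMem_core h
      exact ⟨j, hj⟩

/-- If deleting leaves never ends and the leaves come in pairs at every stage, then a coloring in
which siblings have different colors is distinguishing. -/
theorem exists_rigidOn_of_forall_paired {G : SimpleGraph V} (hG : Subcubic G)
    (hc : G.Preconnected) (hP : ∀ k, Paired G (core G k))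
    (hl : ∃ v p, Pendant G Set.univ v p) : ∃ c, RigidOn G Set.univ c := by
  choose lev par hpar using exists_pendant_of_forall_paired hc hP hl
  have hlev : ∀ x, lev (par x) = lev x + 1 := by
    intro x
    obtain ⟨_, q, _, _, h⟩ := hP _ x _ (hpar x)
    exact (hpar (par x)).core_level_unique (j := lev x + 1) h
  have hmem : ∀ x k, k ≤ lev x → x ∈ core G k := fun x k h => core_antitone G h (hpar x).1
  -- Whichever endpoint is deleted no later than the other has that other as its only remaining
  -- neighbor.
  have hadj : ∀ x y, G.Adj x y → y = par x ∨ x = par y := by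
    intro x y ha
    rcases le_total (lev x) (lev y) with h | h
    · exact .inl ((hpar x).eq (hmem y _ h) ha)
    · exact .inr ((hpar y).eq (hmem x _ h) ha.symm)
  have hanc : ∀ x y, ∃ a b, par^[a] x = par^[b] y := by
    intro x y
    have := (SimpleGraph.reachable_iff_reflTransGen _ _).1 (hc x y)
    induction this with
    | refl => exact ⟨0, 0, rfl⟩
    | @tail y z _ hyz ih =>
      obtain ⟨a, b, h⟩ := ih
      rcases hadj y z hyz with rfl | rfl
      · refine ⟨a + 1, b, ?_⟩
        rw [Function.iterate_succ_apply', h, ← Function.iterate_succ_apply' par,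
          Function.iterate_succ_apply]
      · exact ⟨a, b + 1, by rw [h, Function.iterate_succ_apply]⟩
  have hlevit : ∀ a x, lev (par^[a] x) = lev x + a := by
    intro a
    induction a with
    | zero => intro x; rfl
    | succ a ih => intro x; rw [Function.iterate_succ_apply', hlev, ih]; omega
  obtain ⟨s, -, hs⟩ := exists_separating_set (fun x y => x ≠ y ∧ par x = par y)
    (fun x y h => ⟨h.1.symm, h.2.symm⟩) (fun x h => h.1 rfl)
    (by
      rintro x y z ⟨h1, h2⟩ ⟨k1, k2⟩
      have e : ∀ w, par x = par w → Pendant G (core G (lev x)) w (par x) := by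
        intro w hw
        have := hlev x
        rw [hw, hlev w] at this
        have h := hpar w
        rwa [Nat.succ_injective this, ← hw] at h
      exact (hP _).eq_of_ne hG (hpar x) (e y h2) (e z k2) h1 k1)
  refine ⟨s, fun φ hφ => ?_⟩
  have hφp : ∀ x, Pendant G (core G (lev x)) (φ x) (φ (par x)) := fun x =>
    (pendant_map φ (map_mem_core φ _)).2 (hpar x)
  have hφlev : ∀ x, lev (φ x) = lev x := fun x => (hpar (φ x)).core_level_unique (hφp x)
  have hφpar : ∀ x, par (φ x) = φ (par x) := by
    intro x
    have h := hpar (φ x)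
    rw [hφlev] at h
    exact (hφp x).unique h
  have hφit : ∀ a x, par^[a] (φ x) = φ (par^[a] x) := by
    intro a
    induction a with
    | zero => intro x; rfl
    | succ a ih => intro x; rw [Function.iterate_succ_apply', ih, hφpar,
        Function.iterate_succ_apply']
  have hdown : ∀ a x, φ (par^[a] x) = par^[a] x → φ x = x := by
    intro a
    induction a with
    | zero => intro x h; exact h
    | succ a ih =>
      intro x h
      apply ih
      rw [Function.iterate_succ_apply'] at h
      by_contra hne
      exact hs _ _ ⟨Ne.symm hne, by rw [hφpar, h]⟩ (hφ _ trivial)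
  intro x _
  -- As `φ` preserves levels, the common ancestor lies equally far above `x` and `φ x`; since `φ`
  -- commutes with `par`, it fixes that ancestor.
  obtain ⟨a, b, h⟩ := hanc x (φ x)
  have hab : a = b := by
    have := congrArg lev h
    rw [hlevit, hlevit, hφlev] at this
    omega
  subst hab
  exact hdown a x (by rw [← hφit, ← h])

/-! ### Peeling that ends in a claw -/

theorem encard_neighborSet_eq_three {G : SimpleGraph V} (hG : Subcubic G) {v a b c : V}
    (hab : a ≠ b) (hac : a ≠ c) (hbc : b ≠ c) (ha : G.Adj v a) (hb : G.Adj v b)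
    (hc : G.Adj v c) : (G.neighborSet v).encard = 3 := by
  have : G.neighborSet v = {a, b, c} := by
    ext z
    simp only [SimpleGraph.mem_neighborSet, Set.mem_insert_iff, Set.mem_singleton_iff]
    constructor
    · intro hz
      rcases hG v z a b c hz ha hb hc with h | h | h | h | h | h <;> tauto
    · rintro (rfl | rfl | rfl) <;> assumption
  rw [this, Set.encard_eq_three]
  exact ⟨a, b, c, hab, hac, hbc, rfl⟩

/-- If the leaves come in pairs until deleting leaves ends in a claw, the graph is a ternary
tree. -/
theorem isT_of_isClaw_core {G : SimpleGraph V} (hG : Subcubic G) (hc : G.Connected) {k : ℕ}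
    (hP : ∀ i < k, Paired G (core G i)) {r : V} (hr : IsClaw G (core G k) r) :
    IsT (k + 1) 3 G := by
  classical
  obtain ⟨a, b, c, hab, hac, hbc, ha, hb, hc', hcore⟩ := hr
  have hrk : ∀ i ≤ k, ∀ p, ¬ Pendant G (core G i) r p := by
    intro i hi p hp
    have hmem : ∀ x ∈ core G k, x ∈ core G i := fun x hx => core_antitone G hi hx
    exact hab ((hp.eq (hmem a ha.1) ha.2.2.1.symm).trans (hp.eq (hmem b hb.1) hb.2.2.1.symm).symm)
  have hclaw : ∀ x ∈ core G k, x ≠ r → Pendant G (core G k) x r := by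
    intro x hx hxr
    rcases hcore x hx with rfl | rfl | rfl | rfl
    · exact absurd rfl hxr
    all_goals assumption
  -- The center is never deleted as a leaf: it gets level `k + 1`, one above the leaves of the claw,
  -- and itself as a dummy parent.
  have hex : ∀ x, ∃ i p, (x = r ∧ i = k + 1 ∧ p = r) ∨
      (x ≠ r ∧ i ≤ k ∧ Pendant G (core G i) x p) := by
    intro x
    by_cases hxr : x = r
    · exact ⟨k + 1, r, .inl ⟨hxr, rfl, rfl⟩⟩
    by_cases hx : x ∈ core G k
    · exact ⟨k, r, .inr ⟨hxr, le_rfl, hclaw x hx hxr⟩⟩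
    · obtain ⟨i, hi, p, hp⟩ := exists_pendant_of_notMem_core hx
      exact ⟨i, p, .inr ⟨hxr, hi.le, hp⟩⟩
  choose lev par hpar using hex
  have hlr : lev r = k + 1 := by
    rcases hpar r with h | h
    · exact h.2.1
    · exact absurd rfl h.1
  have hne : ∀ x, x ≠ r → lev x ≤ k ∧ Pendant G (core G (lev x)) x (par x) := by
    intro x hx
    rcases hpar x with h | h
    · exact absurd h.1 hx
    · exact h.2
  have hlevel : ∀ i ≤ k, ∀ x p, Pendant G (core G i) x p → x ≠ r ∧ lev x = i ∧ par x = p := by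
    intro i hi x p hp
    have hx : x ≠ r := by
      rintro rfl
      exact hrk i hi p hp
    obtain ⟨-, h⟩ := hne x hx
    have e := h.core_level_unique hp
    rw [e] at h
    exact ⟨hx, e, hp.unique h⟩
  have hlev : ∀ x, x ≠ r → lev (par x) = lev x + 1 := by
    intro x hx
    obtain ⟨h1, h2⟩ := hne x hx
    rcases h1.lt_or_eq with h | h
    · obtain ⟨_, q, _, _, hq⟩ := hP _ h x _ h2
      exact (hlevel (lev x + 1) h _ q hq).2.1
    · rw [h] at h2
      rw [h, ← hlr, h2.unique (hclaw x h2.1 hx)]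
  have hmem : ∀ x i, i ≤ k → i ≤ lev x → x ∈ core G i := by
    intro x i hik hi
    by_cases hx : x = r
    · rw [hx]; exact core_antitone G hik ha.2.1
    · exact core_antitone G hi (hne x hx).2.1
  have hle : ∀ x, lev x ≤ k + 1 := by
    intro x
    by_cases hx : x = r
    · rw [hx, hlr]
    · exact (hne x hx).1.trans (Nat.le_succ k)
  have hadj : ∀ x y, G.Adj x y → (x ≠ r ∧ y = par x) ∨ (y ≠ r ∧ x = par y) := by
    have key : ∀ x y, G.Adj x y → x ≠ r → lev x ≤ lev y → y = par x := fun x y ha hx h =>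
      (hne x hx).2.eq (hmem y _ (hne x hx).1 h) ha
    intro x y hxy
    by_cases hx : x = r
    · have hy : y ≠ r := fun hy => hxy.ne (hx.trans hy.symm)
      exact .inr ⟨hy, key y x hxy.symm hy (by rw [hx, hlr]; exact hle y)⟩
    by_cases hy : y = r
    · exact .inl ⟨hx, key x y hxy hx (by rw [hy, hlr]; exact hle x)⟩
    rcases le_total (lev x) (lev y) with h | h
    · exact .inl ⟨hx, key x y hxy hx h⟩
    · exact .inr ⟨hy, key y x hxy.symm hy h⟩
  -- Each further level down consists of neighbors of vertices above it, and valences are finite.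
  have hfin : ∀ j, {x | k + 1 ≤ lev x + j}.Finite := by
    intro j
    induction j with
    | zero =>
      refine (Set.finite_singleton r).subset fun x hx => ?_
      by_contra hxr
      have := (hne x hxr).1
      simp only [Set.mem_ofPred_eq] at hx
      omega
    | succ j ih =>
      have hnb : ∀ v, (G.neighborSet v).Finite := by
        intro v
        by_contra hinf
        obtain ⟨t, ht, hcard⟩ := Set.Infinite.exists_subset_card_eq hinf 4
        obtain ⟨w, x, y, z, h1, h2, h3, h4, h5, h6, rfl⟩ := Finset.card_eq_four.1 hcard
        simp only [Finset.coe_insert, Finset.coe_singleton, Set.insert_subset_iff,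
          Set.singleton_subset_iff, SimpleGraph.mem_neighborSet] at ht
        have := hG v w x y z ht.1 ht.2.1 ht.2.2.1 ht.2.2.2
        tauto
      refine ((ih.biUnion fun v _ => hnb v).union (Set.finite_singleton r)).subset fun x hx => ?_
      by_cases hxr : x = r
      · exact .inr hxr
      · refine .inl (Set.mem_biUnion (x := par x) ?_ (hne x hxr).2.2.2.1.symm)
        simp only [Set.mem_ofPred_eq] at hx ⊢
        rw [hlev x hxr]
        omega
  have hfinite : Finite V := by
    refine Set.finite_univ_iff.1 ((hfin (k + 1)).subset fun x _ => ?_)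
    simp
  have htree : G.IsTree := by
    rw [SimpleGraph.isTree_iff_connected_and_card]
    refine ⟨hc, le_antisymm ?_ hc.card_vert_le_card_edgeSet_add_one⟩
    -- Every edge joins some vertex other than `r` to its parent, so there are fewer edges than
    -- vertices.
    let f : {x // x ≠ r} → G.edgeSet := fun x => ⟨s(x.1, par x.1), (hne x.1 x.2).2.2.2.1⟩
    have hf : Function.Surjective f := by
      rintro ⟨e, he⟩
      induction e with
      | _ x y =>
        rcases hadj x y he with ⟨h1, rfl⟩ | ⟨h1, rfl⟩
        · exact ⟨⟨x, h1⟩, rfl⟩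
        · exact ⟨⟨y, h1⟩, Subtype.ext Sym2.eq_swap⟩
    have h1 := Nat.card_le_card_of_surjective f hf
    have := Fintype.ofFinite V
    have h2 : Nat.card {x // x ≠ r} + 1 = Nat.card V := by
      have := Fintype.card_pos_iff.2 ⟨r⟩
      rw [Nat.card_eq_fintype_card, Nat.card_eq_fintype_card, Fintype.card_subtype_compl,
        Fintype.card_subtype_eq]
      omega
    omega
  have hval0 : ∀ x, lev x = 0 → valence G x = 1 := by
    intro x hx
    have hxr : x ≠ r := by rintro rfl; omega
    have h := (hne x hxr).2
    rw [hx] at h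
    rw [valence, Set.encard_eq_one]
    refine ⟨par x, Set.ext fun z => ⟨fun hz => h.eq trivial hz, ?_⟩⟩
    rintro rfl
    exact h.2.2.1
  have hval3 : ∀ x, lev x ≠ 0 → valence G x = 3 := by
    intro x hx
    by_cases hxr : x = r
    · rw [hxr]
      exact encard_neighborSet_eq_three hG hab hac hbc ha.2.2.1.symm hb.2.2.1.symm hc'.2.2.1.symm
    obtain ⟨h1, h2⟩ := hne x hxr
    obtain ⟨i, hi⟩ := Nat.exists_eq_succ_of_ne_zero hx
    -- One stage before `x` becomes a leaf, it still has a neighbor `y` besides its parent. This `y`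
    -- is deleted at that stage, so pairing supplies its sibling `w` and a third, surviving neighbor
    -- of `x`.
    have hpx : ¬ Pendant G (core G i) x (par x) := fun h => by
      have := h.core_level_unique h2
      omega
    have hxi := hmem x i (by omega) (by omega)
    have hpi := core_antitone G (show i ≤ lev x by omega) h2.2.1
    have hy : ∃ y ∈ core G i, G.Adj x y ∧ y ≠ par x := by
      by_contra hno
      push Not at hno
      exact hpx ⟨hxi, hpi, h2.2.2.1, hno⟩
    obtain ⟨y, hyi, hxy, hyp⟩ := hy
    have hyp' : ∃ z, Pendant G (core G i) y z := by
      by_contra hno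
      push Not at hno
      have hy1 : y ∈ core G (lev x) := by
        rw [hi]
        exact ⟨hyi, hno⟩
      exact hyp (h2.eq hy1 hxy)
    obtain ⟨z, hz⟩ := hyp'
    obtain rfl := hz.eq hxi hxy.symm
    obtain ⟨w, q, hwy, hw, hq⟩ := hP i (by omega) y x hz
    have hqp : ∀ u, Pendant G (core G i) u x → u ≠ q := by
      rintro u hu rfl
      exact hq.2.1.2 x hu
    exact encard_neighborSet_eq_three hG hwy (hqp w hw) (hqp y hz) hw.2.2.1.symm hxy hq.2.2.1
  refine ⟨hfinite, htree, fun v => ?_, r, fun v hv => ?_⟩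
  · by_cases h : lev v = 0
    · exact .inl (hval0 v h)
    · exact .inr (hval3 v h)
  · have hv0 : lev v = 0 := by
      by_contra h
      rw [IsLeaf, hval3 v h] at hv
      exact absurd hv (by decide)
    apply le_antisymm
    · have hup : ∀ j x, lev x + j = k + 1 → G.dist r x ≤ j := by
        intro j
        induction j with
        | zero =>
          intro x hx
          have : x = r := by
            by_contra hxr
            have := (hne x hxr).1
            omega
          simp [this]
        | succ j ih =>
          intro x hx
          have hxr : x ≠ r := by rintro rfl; omega
          have h1 := ih (par x) (by rw [hlev x hxr]; omega)
          have ha := (hne x hxr).2.2.2.1.symm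
          have h2 := hc.dist_triangle (u := r) (v := par x) (w := x)
          rw [SimpleGraph.dist_eq_one_iff_adj.2 ha] at h2
          omega
      exact hup (k + 1) v (by omega)
    · obtain ⟨p, hp⟩ := hc.exists_walk_length_eq_dist r v
      -- Levels change by exactly one along each edge, which bounds the distance from below.
      have hwalk : ∀ {x y : V} (p : G.Walk x y), lev x ≤ lev y + p.length := by
        intro x y p
        induction p with
        | nil => simp
        | @cons x z y h p ih =>
          rw [SimpleGraph.Walk.length_cons]
          rcases hadj _ _ h with ⟨h1, h2⟩ | ⟨h1, h2⟩
          · have := hlev _ h1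
            rw [← h2] at this
            omega
          · have := hlev _ h1
            rw [← h2] at this
            omega
      have := hwalk p
      omega

/-! ### Translation from valences and to two colors -/

theorem subcubic_of_valence_le {G : SimpleGraph V} (h : ∀ v, valence G v ≤ 3) : Subcubic G := by
  classical
  intro v a b c d ha hb hc hd
  by_contra hcon
  push Not at hcon
  obtain ⟨h1, h2, h3, h4, h5, h6⟩ := hcon
  have hcard : ({a, b, c, d} : Finset V).card = 4 :=
    Finset.card_eq_four.2 ⟨a, b, c, d, h1, h2, h3, h4, h5, h6, rfl⟩
  have hsub : (({a, b, c, d} : Finset V) : Set V) ⊆ G.neighborSet v := by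
    intro x hx
    simp only [Finset.coe_insert, Finset.coe_singleton, Set.mem_insert_iff,
      Set.mem_singleton_iff] at hx
    rcases hx with rfl | rfl | rfl | rfl <;> assumption
  have := (Set.encard_le_encard hsub).trans (h v)
  rw [Set.encard_coe_eq_coe_finsetCard, hcard] at this
  exact absurd this (by decide)

theorem distinguishingNumber_le_two {G : SimpleGraph V} (h : ∃ c, RigidOn G Set.univ c) :
    distinguishingNumber G ≤ 2 := by
  classical
  obtain ⟨c, hc⟩ := h
  refine iInf₂_le 2 ⟨fun v => if c v then 1 else 0, fun φ hφ v => hc φ (fun w _ => ?_) v trivial⟩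
  have := hφ w
  by_cases h1 : c (φ w) <;> by_cases h2 : c w <;> simp_all

end Distinguishing

theorem theorem4p1 {V : Type*} (G : SimpleGraph V) (hconn : G.Connected)
    (hmax : Distinguishing.HasMaxValence G 3)
    (hleaf : ∃ v, Distinguishing.IsLeaf G v) :
    Distinguishing.distinguishingNumber G ≤ 2 ∨
      ∃ n : ℕ, 1 ≤ n ∧ Distinguishing.IsT n 3 G := by
  classical
  have hG : Distinguishing.Subcubic G :=
    Distinguishing.subcubic_of_valence_le fun v => hmax.2 ⟨v, rfl⟩
  have hl : ∃ v p, Distinguishing.Pendant G Set.univ v p := by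
    obtain ⟨v, hv⟩ := hleaf
    obtain ⟨p, hp⟩ := Set.encard_eq_one.1 hv
    have hadj : ∀ q, G.Adj v q ↔ q = p := fun q => by
      rw [← SimpleGraph.mem_neighborSet, hp, Set.mem_singleton_iff]
    exact ⟨v, p, trivial, trivial, (hadj p).2 rfl, fun q _ ha => (hadj q).1 ha⟩
  by_cases hn : ∃ c, Distinguishing.RigidOn G Set.univ c
  · exact .inl (Distinguishing.distinguishingNumber_le_two hn)
  by_cases hclaw : ∃ k r, Distinguishing.IsClaw G (Distinguishing.core G k) r
  · obtain ⟨r, hr⟩ := Nat.find_spec hclaw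
    have hmin : ∀ i < Nat.find hclaw, ∀ r, ¬ Distinguishing.IsClaw G (Distinguishing.core G i) r :=
      fun i hi r h => Nat.find_min hclaw hi ⟨r, h⟩
    exact .inr ⟨_, Nat.le_add_left 1 _, Distinguishing.isT_of_isClaw_core hG hconn
      (Distinguishing.core_step hG hconn.preconnected hl hn _ hmin).1 hr⟩
  · push Not at hclaw
    exact absurd (Distinguishing.exists_rigidOn_of_forall_paired hG hconn.preconnected
      (fun k => (Distinguishing.core_step hG hconn.preconnected hl hn (k + 1)
        fun i _ => hclaw i).1 k (Nat.lt_succ_self k)) hl) hn
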